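/- Let $d,n\ge 1$ be integers and let $\nu$ be a finite non-negative Borel measure on $[0,\infty)$ with $\operatorname{supp}(\nu)\neq\{0\}$ and $$\int_0^\infty t^{-d/2}\,d\nu(t)<\infty$$ (with $t^{-d/2}=\infty$ at $t=0$). Let $k(x,y)=\int_0^\infty e^{-t\|x-y\|_2^2}\,d\nu(t)$, $x,y\in\mathbb{R}^d$, be the associated radial kernel, $\mathcal{H}_k$ its reproducing kernel Hilbert space, and for a Borel probability measure $P$ on $\mathbb{R}^d$ let $\mu_k(P)=\int k(\cdot,x)\,dP(x)\in\mathcal{H}_k$ (Bochner integral) be its kernel mean embedding. Let $\mathcal{P}$ be the set of Borel probability measures on $\mathbb{R}^d$ that have an infinitely continuously differentiable density with respect to Lebesgue measure. Assume that there are $0<\delta_0\le\delta_1<\infty$ and $0<\beta<\infty$ such that $\nu([\delta_0,\delta_1])\ge\beta$. Then $\mu_k(P)\in L^2(\mathbb{R}^d)$ for every $P\in\mathcal{P}$, and $$\inf_{\hat\theta_n}\ \sup_{P\in\mathcal{P}}\ P^n\left\{\|\hat\theta_n-\mu_k(P)\|_{L^2(\mathbb{R}^d)}\ \ge\ \frac1{50}\sqrt{\frac1n\left(\frac{\pi}{2\delta_1}\right)^{d/2}\frac{\beta^2\delta_0}{\delta_1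 e}\left(1-\frac{2}{2+d}\right)}\right\}\ \ge\ \frac15,$$ where $P^n$ is the $n$-fold product measure and the infimum is over all estimators, i.e. all Borel measurable maps $\hat\theta_n:(\mathbb{R}^d)^n\to L^2(\mathbb{R}^d)$ of the sample $(X_1,\dots,X_n)$. -/

import Mathlib

open MeasureTheory
open scoped ENNReal NNReal

noncomputable section

namespace RadialKME

/-- The radial kernel `k(x, y) = ∫ exp(-t ‖x - y‖²) dν(t)`, where `ν` is a measure on `[0, ∞)`. -/
def radialKernel {d : ℕ} (ν : Measure ℝ≥0) (x y : EuclideanSpace ℝ (Fin d)) : ℝ :=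
  ∫ t : ℝ≥0, Real.exp (-(t : ℝ) * ‖x - y‖ ^ 2) ∂ν

/-- The radial kernel as an operator-valued matrix: the entry at `(x, y)` is multiplication by
the real number `k(x, y)`. -/
def kernelMatrix (d : ℕ) (ν : Measure ℝ≥0) :
    Matrix (EuclideanSpace ℝ (Fin d)) (EuclideanSpace ℝ (Fin d)) (ℝ →L[ℝ] ℝ) :=
  Matrix.of fun x y => radialKernel ν x y • ContinuousLinearMap.id ℝ ℝ

theorem integrable_exp_kernel {d : ℕ} (ν : Measure ℝ≥0) [IsFiniteMeasure ν]
    (x y : EuclideanSpace ℝ (Fin d)) :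
    Integrable (fun t : ℝ≥0 => Real.exp (-(t : ℝ) * ‖x - y‖ ^ 2)) ν := by
  refine Integrable.of_bound (C := 1) (by fun_prop) (ae_of_all _ fun t => ?_)
  rw [Real.norm_eq_abs, Real.abs_exp, Real.exp_le_one_iff]
  have : 0 ≤ (t : ℝ) * ‖x - y‖ ^ 2 := by positivity
  linarith

theorem radialKernel_comm {d : ℕ} (ν : Measure ℝ≥0) (x y : EuclideanSpace ℝ (Fin d)) :
    radialKernel ν x y = radialKernel ν y x := by
  simp only [radialKernel, norm_sub_rev]

/-- The Gaussian kernel is positive semidefinite. -/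
theorem gaussian_nonneg {d : ℕ} (t : ℝ≥0) (s : Finset (EuclideanSpace ℝ (Fin d)))
    (c : EuclideanSpace ℝ (Fin d) → ℝ) :
    0 ≤ ∑ x ∈ s, ∑ y ∈ s, c x * c y * Real.exp (-(t : ℝ) * ‖x - y‖ ^ 2) := by
  rcases eq_or_lt_of_le (show (0 : ℝ≥0) ≤ t from t.2) with rfl | ht
  · simp only [NNReal.coe_zero, neg_zero, zero_mul, Real.exp_zero, mul_one]
    rw [← Finset.sum_mul_sum]
    exact mul_self_nonneg _
  have ht' : (0 : ℝ) < t := by exact_mod_cast ht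
  have h4 : (0 : ℝ) < 4 * t := by linarith
  have hint : ∀ a : EuclideanSpace ℝ (Fin d),
      Integrable (fun z : EuclideanSpace ℝ (Fin d) => Real.exp (-(4 * (t : ℝ)) * ‖z - a‖ ^ 2)) := by
    intro a
    have h0 : Integrable (fun z : EuclideanSpace ℝ (Fin d) =>
        Real.exp (-(4 * (t : ℝ)) * ‖z‖ ^ 2)) := by
      have := (GaussianFourier.integrable_cexp_neg_mul_sq_norm_add
        (V := EuclideanSpace ℝ (Fin d)) (b := ((4 * t : ℝ) : ℂ)) (by simpa using ht) 0 0).norm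
      refine this.congr (ae_of_all _ fun z => ?_)
      simp only [Complex.norm_exp]
      congr 1
      simp [← Complex.ofReal_pow]
    exact h0.comp_sub_right a
  have hmid : ∀ x y z : EuclideanSpace ℝ (Fin d),
      Real.exp (-(2 * (t : ℝ)) * ‖z - x‖ ^ 2) * Real.exp (-(2 * (t : ℝ)) * ‖z - y‖ ^ 2) =
      Real.exp (-(t : ℝ) * ‖x - y‖ ^ 2) *
        Real.exp (-(4 * (t : ℝ)) * ‖z - (2⁻¹ : ℝ) • (x + y)‖ ^ 2) := by
    intro x y z
    rw [← Real.exp_add, ← Real.exp_add]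
    congr 1
    have h1 := parallelogram_law_with_norm ℝ (z - x) (z - y)
    have e1 : (z - x) + (z - y) = (2 : ℝ) • (z - (2⁻¹ : ℝ) • (x + y)) := by module
    have e2 : (z - x) - (z - y) = -(x - y) := by abel
    rw [e1, e2, norm_smul, norm_neg, Real.norm_of_nonneg zero_le_two] at h1
    linear_combination (t : ℝ) * h1
  set I : ℝ := ∫ z : EuclideanSpace ℝ (Fin d), Real.exp (-(4 * (t : ℝ)) * ‖z‖ ^ 2) with hI
  have hIpos : 0 < I := by
    rw [hI]
    refine (integral_pos_iff_support_of_nonneg (fun z => (Real.exp_pos _).le)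
      (by simpa using hint 0)).2 ?_
    rw [Function.support_eq_univ (fun z => (Real.exp_pos _).ne')]
    exact Measure.measure_univ_pos.2 (NeZero.ne _)
  have hkey : (∑ x ∈ s, ∑ y ∈ s, c x * c y * Real.exp (-(t : ℝ) * ‖x - y‖ ^ 2)) * I =
      ∫ z : EuclideanSpace ℝ (Fin d), (∑ x ∈ s, c x * Real.exp (-(2 * (t : ℝ)) * ‖z - x‖ ^ 2)) *
        (∑ y ∈ s, c y * Real.exp (-(2 * (t : ℝ)) * ‖z - y‖ ^ 2)) := by
    have hterm : ∀ x y z : EuclideanSpace ℝ (Fin d),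
        (c x * Real.exp (-(2 * (t : ℝ)) * ‖z - x‖ ^ 2)) *
          (c y * Real.exp (-(2 * (t : ℝ)) * ‖z - y‖ ^ 2)) =
        (c x * c y * Real.exp (-(t : ℝ) * ‖x - y‖ ^ 2)) *
          Real.exp (-(4 * (t : ℝ)) * ‖z - (2⁻¹ : ℝ) • (x + y)‖ ^ 2) := by
      intro x y z
      linear_combination c x * c y * hmid x y z
    simp_rw [Finset.sum_mul_sum, hterm]
    rw [integral_finsetSum _ fun x _ => integrable_finsetSum _ fun y _ =>
      (hint _).const_mul _, Finset.sum_mul]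
    refine Finset.sum_congr rfl fun x _ => ?_
    rw [integral_finsetSum _ fun y _ => (hint _).const_mul _, Finset.sum_mul]
    refine Finset.sum_congr rfl fun y _ => ?_
    rw [integral_const_mul,
      integral_sub_right_eq_self
        (fun z : EuclideanSpace ℝ (Fin d) => Real.exp (-(4 * (t : ℝ)) * ‖z‖ ^ 2))]
  refine nonneg_of_mul_nonneg_left (b := I) ?_ hIpos
  rw [hkey]
  exact integral_nonneg fun z => mul_self_nonneg _

/-- The radial kernel of a finite measure `ν` on `[0, ∞)` is positive semidefinite. -/
theorem posSemidef_kernelMatrix (d : ℕ) (ν : Measure ℝ≥0) [IsFiniteMeasure ν] :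
    (kernelMatrix d ν).PosSemidef := by
  refine ((RKHS.posSemidef_tfae (𝕜 := ℝ) (K := kernelMatrix d ν)).out 0 2).2
    (And.intro ?_ fun vv => ?_)
  · have hid : ContinuousLinearMap.adjoint (ContinuousLinearMap.id ℝ ℝ) =
        ContinuousLinearMap.id ℝ ℝ := star_one (ℝ →L[ℝ] ℝ)
    ext x y
    simp [kernelMatrix, radialKernel_comm ν x y, star, hid]
  · have h : ∀ x y : EuclideanSpace ℝ (Fin d), vv x * vv y * radialKernel ν x y =
        ∫ t : ℝ≥0, vv x * vv y * Real.exp (-(t : ℝ) * ‖x - y‖ ^ 2) ∂ν := fun x y =>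
      (integral_const_mul _ _).symm
    have h2 : 0 ≤ ∑ x ∈ vv.support, ∑ y ∈ vv.support, vv x * vv y * radialKernel ν x y := by
      simp_rw [h]
      have : (∑ x ∈ vv.support, ∑ y ∈ vv.support,
          ∫ t : ℝ≥0, vv x * vv y * Real.exp (-(t : ℝ) * ‖x - y‖ ^ 2) ∂ν) =
          ∫ t : ℝ≥0, ∑ x ∈ vv.support, ∑ y ∈ vv.support,
            vv x * vv y * Real.exp (-(t : ℝ) * ‖x - y‖ ^ 2) ∂ν := by
        rw [integral_finsetSum _ fun x _ => integrable_finsetSum _ fun y _ =>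
          (integrable_exp_kernel ν x y).const_mul _]
        refine Finset.sum_congr rfl fun x _ => ?_
        rw [integral_finsetSum _ fun y _ => (integrable_exp_kernel ν x y).const_mul _]
      rw [this]
      exact integral_nonneg fun t => gaussian_nonneg t _ _
    convert h2 using 1
    simp only [Finsupp.sum, kernelMatrix, RCLike.re_to_real]
    refine Finset.sum_congr rfl fun x _ => Finset.sum_congr rfl fun y _ => ?_
    simp [radialKernel_comm ν y x]
    ring

instance instFactPosSemidef (d : ℕ) (ν : Measure ℝ≥0) [IsFiniteMeasure ν] :
    Fact (kernelMatrix d ν).PosSemidef :=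
  ⟨posSemidef_kernelMatrix d ν⟩

/-- The reproducing kernel Hilbert space `H_k` of the radial kernel `k` of `ν` on `ℝ^d`. -/
abbrev RadialRKHS (d : ℕ) (ν : Measure ℝ≥0) [IsFiniteMeasure ν] : Type :=
  RKHS.OfKernel (kernelMatrix d ν)

/-- The function `k(·, x)` as an element of `H_k`. -/
def feature {d : ℕ} (ν : Measure ℝ≥0) [IsFiniteMeasure ν] (x : EuclideanSpace ℝ (Fin d)) :
    RadialRKHS d ν :=
  RKHS.kerFun (RadialRKHS d ν) x (1 : ℝ)

theorem feature_apply {d : ℕ} (ν : Measure ℝ≥0) [IsFiniteMeasure ν]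
    (x y : EuclideanSpace ℝ (Fin d)) : feature ν x y = radialKernel ν y x := by
  have h := RKHS.kerFun_apply (RadialRKHS d ν) x (1 : ℝ) y
  rw [RKHS.OfKernel.kernel_ofKernel] at h
  exact h.trans (by simp [kernelMatrix])

/-- The kernel mean embedding `μ_k(P) = ∫ k(·, x) dP(x)`, a Bochner integral in `H_k`. -/
def kernelMean {d : ℕ} (ν : Measure ℝ≥0) [IsFiniteMeasure ν]
    (P : Measure (EuclideanSpace ℝ (Fin d))) : RadialRKHS d ν :=
  ∫ x, feature ν x ∂P

/-- The Borel probability measures on `ℝ^d` that have an infinitely differentiable density with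
respect to Lebesgue measure. -/
def smoothDensityLaws (d : ℕ) : Set (Measure (EuclideanSpace ℝ (Fin d))) :=
  {P | IsProbabilityMeasure P ∧ ∃ p : EuclideanSpace ℝ (Fin d) → ℝ,
    ContDiff ℝ (⊤ : ℕ∞) p ∧ (∀ x, 0 ≤ p x) ∧
      P = volume.withDensity fun x => ENNReal.ofReal (p x)}

/-- Estimators with values in `L²(ℝ^d)` based on a sample of size `n`: the Borel measurable maps
`(ℝ^d)^n → L²(ℝ^d)`. -/
def L2Estimator (d n : ℕ) : Type :=
  {θ : (Fin n → EuclideanSpace ℝ (Fin d)) →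
      Lp ℝ 2 (volume : Measure (EuclideanSpace ℝ (Fin d))) //
    Measurable[MeasurableSpace.pi, borel _] θ}

/-- The `L²(ℝ^d)` distance between `f` in `L²(ℝ^d)` and a function `g` on `ℝ^d`. -/
def l2Error {d : ℕ} (f : Lp ℝ 2 (volume : Measure (EuclideanSpace ℝ (Fin d))))
    (g : EuclideanSpace ℝ (Fin d) → ℝ) : ℝ≥0∞ :=
  eLpNorm (fun y => f y - g y) 2 volume

/-- The minimax probability
`inf_θ sup_P P^n {‖θ(X_1, …, X_n) - μ_k(P)‖_{L²(ℝ^d)} ≥ s}` over all `L²(ℝ^d)`-valued estimators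
`θ` and all `P` with an infinitely differentiable density. -/
def minimaxProbability (d n : ℕ) (ν : Measure ℝ≥0) [IsFiniteMeasure ν] (s : ℝ) : ℝ≥0∞ :=
  ⨅ θ : L2Estimator d n, ⨆ P ∈ smoothDensityLaws d,
    Measure.pi (fun _ : Fin n => P)
      {X | ENNReal.ofReal s ≤ l2Error (θ.1 X) (kernelMean ν P)}

end RadialKME

end

/-! The lower bound is Le Cam's two-point method. Let `p` be a smooth density concentrated near the
origin and `q` a smooth density with tiny supremum. The competing laws have densities `m = (p + q) /
2` and `m + ε (p - q)` with `ε² = 1 / (100 n)`.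

They are hard to distinguish: `|p - q| ≤ 2 m` bounds their `χ²`-divergence by `4 ε²`, whatever `p`
and `q` are, and the `χ²`-bound tensorizes (`pi_mixture_real_le`). So the probabilities of an event
under the two samples differ by at most `√((1 + 4 ε²)^n - 1) ≤ 3/5`.

Their embeddings are far apart: the embedding is affine in the law, so the difference is `ε` times
that of `p` and `q`. The embedding of `p` dominates a Gaussian of height about `β`, while that of
`q` is uniformly small, which bounds the squared `L²` distance below by `N / 2` with `N = β² e⁻¹ (π
/ (2 δ₁))^(d/2)` (`exists_separated`). The factors `δ₀ / δ₁` and `1 - 2 / (2 + d)` of the rate are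
at most one and are simply given away.

Membership in `L²` holds because an embedding is bounded and, by Tonelli and the moment condition,
integrable. -/

namespace RadialKME

/-! ### Integrability of the radial kernel and of the mean embedding -/

section Kernel

variable {d : ℕ} (ν : Measure ℝ≥0)

theorem radialKernel_nonneg (x y : EuclideanSpace ℝ (Fin d)) : 0 ≤ radialKernel ν x y :=
  integral_nonneg fun _ => (Real.exp_pos _).le

theorem radialKernel_eq_sub (x y : EuclideanSpace ℝ (Fin d)) :
    radialKernel ν x y = radialKernel ν (x - y) 0 := by
  simp [radialKernel]

theorem integral_radialKernel (x : EuclideanSpace ℝ (Fin d)) :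
    ∫ y, radialKernel ν y x = ∫ y : EuclideanSpace ℝ (Fin d), radialKernel ν y 0 := by
  simp_rw [fun y => radialKernel_eq_sub ν y x]
  exact integral_sub_right_eq_self (fun y => radialKernel ν y 0) x

variable [IsFiniteMeasure ν]

theorem radialKernel_le (x y : EuclideanSpace ℝ (Fin d)) :
    radialKernel ν x y ≤ ν.real Set.univ := by
  have h : radialKernel ν x y ≤ ∫ _ : ℝ≥0, (1 : ℝ) ∂ν := by
    refine integral_mono (integrable_exp_kernel ν x y) (integrable_const _) fun t => ?_
    have : 0 ≤ (t : ℝ) * ‖x - y‖ ^ 2 := by positivity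
    exact Real.exp_le_one_iff.2 (by linarith)
  simpa using h

theorem continuous_radialKernel {Y : Type*} [TopologicalSpace Y] [FirstCountableTopology Y]
    {f g : Y → EuclideanSpace ℝ (Fin d)} (hf : Continuous f) (hg : Continuous g) :
    Continuous fun a => radialKernel ν (f a) (g a) := by
  refine continuous_of_dominated (bound := fun _ => 1) (fun z => by fun_prop) (fun z => ?_)
    (integrable_const _) (ae_of_all _ fun t => by fun_prop)
  refine ae_of_all _ fun t => ?_
  rw [Real.norm_eq_abs, Real.abs_exp, Real.exp_le_one_iff]
  have : 0 ≤ (t : ℝ) * ‖f z - g z‖ ^ 2 := by positivity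
  linarith

/-- A lower bound for the radial kernel through the mass of a bounded interval. -/
theorem mul_exp_le_radialKernel {δ₀ δ₁ β : ℝ≥0} (hν : (β : ℝ≥0∞) ≤ ν (Set.Icc δ₀ δ₁))
    (x y : EuclideanSpace ℝ (Fin d)) :
    (β : ℝ) * Real.exp (-(δ₁ : ℝ) * ‖x - y‖ ^ 2) ≤ radialKernel ν x y := by
  have hβ : (β : ℝ) ≤ ν.real (Set.Icc δ₀ δ₁) := by
    have := ENNReal.toReal_mono (measure_ne_top ν _) hν
    simpa [measureReal_def] using this
  calc (β : ℝ) * Real.exp (-(δ₁ : ℝ) * ‖x - y‖ ^ 2)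
      ≤ ν.real (Set.Icc δ₀ δ₁) * Real.exp (-(δ₁ : ℝ) * ‖x - y‖ ^ 2) := by gcongr
    _ = ∫ _ in Set.Icc δ₀ δ₁, Real.exp (-(δ₁ : ℝ) * ‖x - y‖ ^ 2) ∂ν := by simp
    _ ≤ ∫ t in Set.Icc δ₀ δ₁, Real.exp (-(t : ℝ) * ‖x - y‖ ^ 2) ∂ν := by
      refine setIntegral_mono_on (integrable_const _) (integrable_exp_kernel ν x y).integrableOn
        measurableSet_Icc fun t ht => ?_
      have : (t : ℝ) ≤ δ₁ := by exact_mod_cast ht.2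
      gcongr
    _ ≤ _ := setIntegral_le_integral (integrable_exp_kernel ν x y)
      (ae_of_all _ fun _ => (Real.exp_pos _).le)

/-- The Gaussian integral, in a form that includes `t = 0`: there the right side is `∞` for `d ≥ 1`,
and for `d = 0` Lebesgue measure is a Dirac mass and both sides are `1`. -/
theorem lintegral_exp_neg_mul_sq_norm_le (t : ℝ≥0) :
    ∫⁻ y : EuclideanSpace ℝ (Fin d), ENNReal.ofReal (Real.exp (-(t : ℝ) * ‖y‖ ^ 2)) ≤
      ENNReal.ofReal (Real.pi ^ ((d : ℝ) / 2)) * (t : ℝ≥0∞) ^ (-(d : ℝ) / 2) := by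
  rcases eq_or_lt_of_le (show (0 : ℝ≥0) ≤ t from t.2) with rfl | ht
  · rcases Nat.eq_zero_or_pos d with rfl | hd
    · simp [volume_euclideanSpace_eq_dirac]
    · have : -(d : ℝ) / 2 < 0 := by
        have : (0 : ℝ) < d := by exact_mod_cast hd
        linarith
      rw [ENNReal.coe_zero, ENNReal.zero_rpow_of_neg this, ENNReal.mul_top]
      · exact le_top
      · simp only [ne_eq, ENNReal.ofReal_eq_zero, not_le]
        positivity
  · have ht' : (0 : ℝ) < t := by exact_mod_cast ht
    have hval := GaussianFourier.integral_rexp_neg_mul_sq_norm (V := EuclideanSpace ℝ (Fin d)) ht'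
    have hint : Integrable fun y : EuclideanSpace ℝ (Fin d) =>
        Real.exp (-(t : ℝ) * ‖y‖ ^ 2) := by
      refine Integrable.of_integral_ne_zero ?_
      rw [hval]
      positivity
    rw [← ofReal_integral_eq_lintegral_ofReal hint (ae_of_all _ fun _ => (Real.exp_pos _).le),
      hval, finrank_euclideanSpace_fin, Real.div_rpow Real.pi_pos.le ht'.le, div_eq_mul_inv,
      ENNReal.ofReal_mul (by positivity), ← Real.rpow_neg ht'.le,
      ← ENNReal.ofReal_rpow_of_pos ht', neg_div]
    simp

/-- Tonelli: integrating the Gaussians in space first leaves the moment of order `-d/2` of `ν`. -/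
theorem integrable_radialKernel_zero
    (hmoment : ∫⁻ t : ℝ≥0, (t : ℝ≥0∞) ^ (-(d : ℝ) / 2) ∂ν < ∞) :
    Integrable fun y : EuclideanSpace ℝ (Fin d) => radialKernel ν y 0 := by
  have hcont : Continuous fun y : EuclideanSpace ℝ (Fin d) => radialKernel ν y 0 :=
    continuous_radialKernel ν continuous_id continuous_const
  refine ⟨hcont.aestronglyMeasurable, ?_⟩
  rw [hasFiniteIntegral_iff_ofReal (ae_of_all _ fun y => radialKernel_nonneg ν y 0)]
  calc ∫⁻ y : EuclideanSpace ℝ (Fin d), ENNReal.ofReal (radialKernel ν y 0)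
      = ∫⁻ y : EuclideanSpace ℝ (Fin d), ∫⁻ t : ℝ≥0,
          ENNReal.ofReal (Real.exp (-(t : ℝ) * ‖y‖ ^ 2)) ∂ν := by
        refine lintegral_congr fun y => ?_
        rw [radialKernel, ofReal_integral_eq_lintegral_ofReal (integrable_exp_kernel ν y 0)
          (ae_of_all _ fun _ => (Real.exp_pos _).le)]
        simp
    _ = ∫⁻ t : ℝ≥0, (∫⁻ y : EuclideanSpace ℝ (Fin d),
          ENNReal.ofReal (Real.exp (-(t : ℝ) * ‖y‖ ^ 2))) ∂ν :=
        lintegral_lintegral_swap (by fun_prop)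
    _ ≤ ∫⁻ t : ℝ≥0, ENNReal.ofReal (Real.pi ^ ((d : ℝ) / 2)) *
          (t : ℝ≥0∞) ^ (-(d : ℝ) / 2) ∂ν :=
        lintegral_mono fun t => lintegral_exp_neg_mul_sq_norm_le t
    _ = ENNReal.ofReal (Real.pi ^ ((d : ℝ) / 2)) *
          ∫⁻ t : ℝ≥0, (t : ℝ≥0∞) ^ (-(d : ℝ) / 2) ∂ν := lintegral_const_mul _ (by fun_prop)
    _ < ∞ := ENNReal.mul_lt_top ENNReal.ofReal_lt_top hmoment

theorem integrable_radialKernel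
    (hmoment : ∫⁻ t : ℝ≥0, (t : ℝ≥0∞) ^ (-(d : ℝ) / 2) ∂ν < ∞)
    (x : EuclideanSpace ℝ (Fin d)) : Integrable fun y => radialKernel ν y x := by
  simp_rw [fun y => radialKernel_eq_sub ν y x]
  exact (integrable_radialKernel_zero ν hmoment).comp_sub_right x

/-- By the reproducing property, `‖k(·, y) - k(·, x)‖² = k(y, y) - 2 k(y, x) + k(x, x)`, so
continuity is inherited from the kernel. It supplies the measurability needed for the Bochner
integral. -/
theorem continuous_feature : Continuous (feature ν : EuclideanSpace ℝ (Fin d) → _) := by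
  have hinner : ∀ x y : EuclideanSpace ℝ (Fin d),
      inner ℝ (feature ν x) (feature ν y) = radialKernel ν x y := by
    intro x y
    rw [← feature_apply, feature, RKHS.kerFun_inner]
    simp
  refine continuous_iff_continuousAt.2 fun x => ?_
  rw [ContinuousAt, tendsto_iff_norm_sub_tendsto_zero]
  have hsq : ∀ y, ‖feature ν y - feature ν x‖ =
      √(radialKernel ν y y - 2 * radialKernel ν y x + radialKernel ν x x) := by
    intro y
    rw [← Real.sqrt_sq (norm_nonneg (feature ν y - feature ν x)), norm_sub_sq_real, hinner,
      ← real_inner_self_eq_norm_sq, ← real_inner_self_eq_norm_sq, hinner, hinner]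
  simp_rw [hsq]
  have hc : Continuous fun y : EuclideanSpace ℝ (Fin d) =>
      √(radialKernel ν y y - 2 * radialKernel ν y x + radialKernel ν x x) :=
    (((continuous_radialKernel ν continuous_id continuous_id).sub
      ((continuous_radialKernel ν continuous_id continuous_const).const_mul 2)).add
        continuous_const).sqrt
  have := hc.tendsto x
  rwa [show radialKernel ν x x - 2 * radialKernel ν x x + radialKernel ν x x = 0 by ring,
    Real.sqrt_zero] at this

theorem integrable_feature (P : Measure (EuclideanSpace ℝ (Fin d))) [IsFiniteMeasure P] :
    Integrable (feature ν) P := by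
  refine Integrable.of_bound (C := √(ν.real Set.univ))
    (continuous_feature ν).aestronglyMeasurable (ae_of_all _ fun x => ?_)
  refine Real.le_sqrt_of_sq_le ?_
  rw [← real_inner_self_eq_norm_sq, feature, RKHS.kerFun_inner, ← feature, feature_apply]
  simpa using radialKernel_le ν x x

/-- Point evaluation is a continuous linear functional on the RKHS, hence commutes with the Bochner
integral. -/
theorem kernelMean_apply (P : Measure (EuclideanSpace ℝ (Fin d))) [IsFiniteMeasure P]
    (y : EuclideanSpace ℝ (Fin d)) : kernelMean ν P y = ∫ x, radialKernel ν y x ∂P := by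
  have h := ((ContinuousLinearMap.proj (R := ℝ) (φ := fun _ : EuclideanSpace ℝ (Fin d) => ℝ) y).comp
    (RKHS.coeCLM ℝ : RadialRKHS d ν →L[ℝ] _)).integral_comp_comm (integrable_feature ν P)
  simp only [ContinuousLinearMap.comp_apply, ContinuousLinearMap.proj_apply,
    RKHS.coeCLM_apply, feature_apply] at h
  exact h.symm

section Mean

variable (P : Measure (EuclideanSpace ℝ (Fin d))) [IsProbabilityMeasure P]

theorem integrable_radialKernel_left (y : EuclideanSpace ℝ (Fin d)) :
    Integrable (fun x => radialKernel ν y x) P := by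
  refine Integrable.of_bound (C := ν.real Set.univ) ?_ (ae_of_all _ fun x => ?_)
  · exact (continuous_radialKernel ν continuous_const continuous_id).aestronglyMeasurable
  · rw [Real.norm_of_nonneg (radialKernel_nonneg ν y x)]
    exact radialKernel_le ν y x

theorem kernelMean_nonneg (y : EuclideanSpace ℝ (Fin d)) : 0 ≤ kernelMean ν P y := by
  rw [kernelMean_apply]
  exact integral_nonneg fun x => radialKernel_nonneg ν y x

theorem kernelMean_le (y : EuclideanSpace ℝ (Fin d)) : kernelMean ν P y ≤ ν.real Set.univ := by
  rw [kernelMean_apply]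
  have := integral_mono (integrable_radialKernel_left ν P y) (integrable_const (μ := P) _)
    (radialKernel_le ν y)
  simpa using this

theorem integrable_radialKernel_prod
    (hmoment : ∫⁻ t : ℝ≥0, (t : ℝ≥0∞) ^ (-(d : ℝ) / 2) ∂ν < ∞) :
    Integrable (fun z : EuclideanSpace ℝ (Fin d) × EuclideanSpace ℝ (Fin d) =>
      radialKernel ν z.1 z.2) (volume.prod P) := by
  rw [integrable_prod_iff' (continuous_radialKernel ν continuous_fst continuous_snd).aestronglyMeasurable]
  refine ⟨ae_of_all _ fun x => integrable_radialKernel ν hmoment x, ?_⟩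
  simp_rw [Real.norm_of_nonneg (radialKernel_nonneg ν _ _), integral_radialKernel]
  exact integrable_const _

theorem integrable_kernelMean
    (hmoment : ∫⁻ t : ℝ≥0, (t : ℝ≥0∞) ^ (-(d : ℝ) / 2) ∂ν < ∞) : Integrable (kernelMean ν P) := by
  have := (integrable_radialKernel_prod ν P hmoment).integral_prod_left
  exact this.congr (ae_of_all _ fun y => (kernelMean_apply ν P y).symm)

theorem integral_kernelMean
    (hmoment : ∫⁻ t : ℝ≥0, (t : ℝ≥0∞) ^ (-(d : ℝ) / 2) ∂ν < ∞) :
    ∫ y, kernelMean ν P y = ∫ y : EuclideanSpace ℝ (Fin d), radialKernel ν y 0 := by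
  simp_rw [kernelMean_apply]
  rw [integral_integral_swap (integrable_radialKernel_prod ν P hmoment)]
  simp [integral_radialKernel]

/-- With `0 ≤ μ_k(P) ≤ ν(univ)`, the square is dominated by a multiple of the integrable function
`μ_k(P)`. -/
theorem memLp_two_kernelMean
    (hmoment : ∫⁻ t : ℝ≥0, (t : ℝ≥0∞) ^ (-(d : ℝ) / 2) ∂ν < ∞) : MemLp (kernelMean ν P) 2 volume := by
  have hint := integrable_kernelMean ν P hmoment
  rw [memLp_two_iff_integrable_sq hint.aestronglyMeasurable]
  refine (hint.const_mul (ν.real Set.univ)).mono' (by fun_prop) (ae_of_all _ fun y => ?_)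
  have h0 := kernelMean_nonneg ν P y
  rw [Real.norm_of_nonneg (by positivity), sq]
  exact mul_le_mul_of_nonneg_right (kernelMean_le ν P y) h0

end Mean

end Kernel

/-! ### Indistinguishability of product laws through the `χ²`-divergence -/

section Testing

variable {X : Type*} [MeasurableSpace X]

theorem pi_withDensity_ofReal {ι : Type*} [Fintype ι] (P : Measure X) [SigmaFinite P]
    {f : X → ℝ} (hf : Integrable f P) (hf0 : ∀ x, 0 ≤ f x) :
    Measure.pi (fun _ : ι => P.withDensity fun x => ENNReal.ofReal (f x)) =
      (Measure.pi fun _ : ι => P).withDensity fun x => ENNReal.ofReal (∏ i, f (x i)) := by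
  have : IsFiniteMeasure (P.withDensity fun x => ENNReal.ofReal (f x)) :=
    isFiniteMeasure_withDensity_ofReal hf.2
  refine Measure.pi_eq fun s hs => ?_
  rw [withDensity_apply _ (MeasurableSet.univ_pi hs), Measure.restrict_pi_pi,
    ← ofReal_integral_eq_lintegral_ofReal (Integrable.fintype_prod fun i => hf.mono_measure
      Measure.restrict_le_self) (ae_of_all _ fun x => Finset.prod_nonneg fun i _ => hf0 _),
    integral_fintype_prod_eq_prod (fun _ => f),
    ENNReal.ofReal_prod_of_nonneg fun i _ => integral_nonneg hf0]
  refine Finset.prod_congr rfl fun i _ => ?_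
  rw [withDensity_apply _ (hs i), ofReal_integral_eq_lintegral_ofReal
    (hf.mono_measure Measure.restrict_le_self) (ae_of_all _ hf0)]

/-- This is nonnegativity of the variance of `|g|`. -/
theorem integral_abs_le_sqrt_integral_sq (P : Measure X) [IsProbabilityMeasure P] {g : X → ℝ}
    (hg : MemLp g 2 P) : ∫ x, |g x| ∂P ≤ √(∫ x, g x ^ 2 ∂P) := by
  have h := ProbabilityTheory.variance_nonneg (fun x => |g x|) P
  rw [ProbabilityTheory.variance_eq_sub (X := fun x => |g x|) hg.abs] at h
  refine Real.le_sqrt_of_sq_le ?_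
  simpa [sq_abs] using h

/-- Comparison of the laws of two samples through the `χ²`-divergence of the laws of one
observation. -/
theorem pi_real_le_pi_withDensity_real_add (P : Measure X) [IsProbabilityMeasure P]
    {f : X → ℝ} (hf : Measurable f) (hf0 : ∀ x, 0 ≤ f x) {C c : ℝ} (hfC : ∀ x, f x ≤ C)
    (hf1 : ∫ x, f x ∂P = 1) (hf2 : ∫ x, f x ^ 2 ∂P ≤ 1 + c) (n : ℕ)
    {A : Set (Fin n → X)} (hA : MeasurableSet A) :
    (Measure.pi fun _ : Fin n => P).real A ≤
      (Measure.pi fun _ : Fin n => P.withDensity fun x => ENNReal.ofReal (f x)).real A +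
        √((1 + c) ^ n - 1) := by
  have hfi : Integrable f P := Integrable.of_bound hf.aestronglyMeasurable C
    (ae_of_all _ fun x => by rw [Real.norm_of_nonneg (hf0 x)]; exact hfC x)
  set μ := Measure.pi fun _ : Fin n => P with hμ
  set L : (Fin n → X) → ℝ := fun x => ∏ i, f (x i) with hL
  have hL0 : ∀ x, 0 ≤ L x := fun x => Finset.prod_nonneg fun i _ => hf0 _
  have hLC : ∀ x, L x ≤ C ^ n := fun x => by
    simpa using Finset.prod_le_prod (s := Finset.univ) (fun i _ => hf0 (x i)) fun i _ => hfC (x i)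
  have hLmem : MemLp L 2 μ := MemLp.of_bound (C := C ^ n)
    (by fun_prop : Measurable L).aestronglyMeasurable
    (ae_of_all _ fun x => by rw [Real.norm_of_nonneg (hL0 x)]; exact hLC x)
  have hLi : Integrable L μ := hLmem.integrable one_le_two
  have hL1 : ∫ x, L x ∂μ = 1 := by
    rw [hμ, hL, integral_fintype_prod_eq_pow, hf1, one_pow]
  have hL2 : ∫ x, L x ^ 2 ∂μ ≤ (1 + c) ^ n := by
    simp_rw [hL, ← Finset.prod_pow]
    rw [hμ, integral_fintype_prod_eq_pow fun x => f x ^ 2, Fintype.card_fin]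
    exact pow_le_pow_left₀ (integral_nonneg fun x => sq_nonneg _) hf2 n
  -- Since the likelihood ratio `L` has mean one, its squared distance to `1` is `∫ L² - 1`, and `∫
  -- L²` factorizes over the coordinates.
  have hsq : ∫ x, (1 - L x) ^ 2 ∂μ ≤ (1 + c) ^ n - 1 := by
    have : ∀ x, (1 - L x) ^ 2 = (1 - 2 * L x) + L x ^ 2 := fun x => by ring
    simp_rw [this]
    have hlin : Integrable (fun x => 1 - 2 * L x) μ := (integrable_const _).sub (hLi.const_mul 2)
    rw [integral_add hlin hLmem.integrable_sq,
      integral_sub (integrable_const _) (hLi.const_mul 2), integral_const_mul, hL1]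
    simp only [integral_const, probReal_univ, smul_eq_mul]
    linarith
  have hmem : MemLp (fun x => 1 - L x) 2 μ := (memLp_const 1).sub hLmem
  have hgi : Integrable (fun x => 1 - L x) μ := hmem.integrable one_le_two
  have hQ : (Measure.pi fun _ : Fin n => P.withDensity fun x => ENNReal.ofReal (f x)).real A =
      ∫ x in A, L x ∂μ := by
    rw [pi_withDensity_ofReal P hfi hf0, measureReal_def, withDensity_apply _ hA,
      ← ofReal_integral_eq_lintegral_ofReal hLi.integrableOn (ae_of_all _ hL0),
      ENNReal.toReal_ofReal (integral_nonneg hL0)]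
  have hP : μ.real A = ∫ x in A, (1 : ℝ) ∂μ := by simp
  rw [hQ, hP, ← sub_le_iff_le_add', ← integral_sub (integrable_const _) hLi.integrableOn]
  calc ∫ x in A, (1 - L x) ∂μ ≤ ∫ x in A, |1 - L x| ∂μ :=
        integral_mono hgi.integrableOn hgi.abs.integrableOn fun x => le_abs_self _
    _ ≤ ∫ x, |1 - L x| ∂μ := setIntegral_le_integral hgi.abs (ae_of_all _ fun _ => abs_nonneg _)
    _ ≤ √(∫ x, (1 - L x) ^ 2 ∂μ) := integral_abs_le_sqrt_integral_sq μ hmem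
    _ ≤ _ := Real.sqrt_le_sqrt hsq

/-- Two laws with densities `(p + q) / 2` and `(p + q) / 2 + ε (p - q)` cannot be told apart well
from `n` observations when `n ε²` is small. -/
theorem pi_mixture_real_le (μ : Measure X) {p q : X → ℝ} (hp : Measurable p) (hq : Measurable q)
    (hp0 : ∀ x, 0 ≤ p x) (hq0 : ∀ x, 0 ≤ q x) (hpi : Integrable p μ) (hqi : Integrable q μ)
    (hp1 : ∫ x, p x ∂μ = 1) (hq1 : ∫ x, q x ∂μ = 1) {ε : ℝ} (hε0 : 0 ≤ ε) (hε : ε ≤ 1 / 2)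
    (n : ℕ) {A : Set (Fin n → X)} (hA : MeasurableSet A) :
    (Measure.pi fun _ : Fin n =>
        μ.withDensity fun x => ENNReal.ofReal ((p x + q x) / 2)).real A ≤
      (Measure.pi fun _ : Fin n =>
        μ.withDensity fun x => ENNReal.ofReal ((p x + q x) / 2 + ε * (p x - q x))).real A +
        √((1 + 4 * ε ^ 2) ^ n - 1) := by
  set m : X → ℝ := fun x => (p x + q x) / 2 with hm
  set f : X → ℝ := fun x => ((p x + q x) / 2 + ε * (p x - q x)) / m x with hf
  have hm0 : ∀ x, 0 ≤ m x := fun x => by have := hp0 x; have := hq0 x; simp only [hm]; linarith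
  have hmi : Integrable m μ := (hpi.add hqi).div_const 2
  have hm1 : ∫ x, m x ∂μ = 1 := by
    simp only [hm]
    rw [integral_div, integral_add hpi hqi, hp1, hq1]
    norm_num
  -- Where `m` vanishes, so do `p` and `q`; the default value of division by zero is harmless.
  have hfm : ∀ x, m x * f x = (p x + q x) / 2 + ε * (p x - q x) := by
    intro x
    by_cases h : m x = 0
    · have := hp0 x; have := hq0 x
      have h' : p x + q x = 0 := by simp only [hm] at h; linarith
      have hpx : p x = 0 := by linarith
      have hqx : q x = 0 := by linarith
      rw [h, hpx, hqx]; ring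
    · simp only [hf]; field_simp
  have hnum0 : ∀ x, 0 ≤ (p x + q x) / 2 + ε * (p x - q x) := fun x => by
    nlinarith [hp0 x, hq0 x]
  have hf0 : ∀ x, 0 ≤ f x := fun x => div_nonneg (hnum0 x) (hm0 x)
  have hfC : ∀ x, f x ≤ 2 := fun x => by
    refine div_le_of_le_mul₀ (hm0 x) zero_le_two ?_
    simp only [hm]
    nlinarith [hp0 x, hq0 x]
  have hfmeas : Measurable f := by fun_prop
  have hP : IsProbabilityMeasure (μ.withDensity fun x => ENNReal.ofReal (m x)) := by
    refine ⟨?_⟩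
    rw [withDensity_apply _ MeasurableSet.univ, Measure.restrict_univ, ← ofReal_integral_eq_lintegral_ofReal hmi (ae_of_all _ hm0), hm1, ENNReal.ofReal_one]
  have hint : ∀ g : X → ℝ, ∫ x, g x ∂(μ.withDensity fun x => ENNReal.ofReal (m x)) =
      ∫ x, m x * g x ∂μ := by
    intro g
    rw [integral_withDensity_eq_integral_toReal_smul (by fun_prop)
      (ae_of_all _ fun x => ENNReal.ofReal_lt_top)]
    simp_rw [ENNReal.toReal_ofReal (hm0 _), smul_eq_mul]
  have hpqi : Integrable (fun x => p x - q x) μ := hpi.sub hqi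
  have hpq : ∫ x, (p x - q x) ∂μ = 0 := by rw [integral_sub hpi hqi, hp1, hq1, sub_self]
  have h := pi_real_le_pi_withDensity_real_add (μ.withDensity fun x => ENNReal.ofReal (m x))
    hfmeas hf0 hfC (c := 4 * ε ^ 2) ?_ ?_ n hA
  · rw [← withDensity_mul _ (by fun_prop) (by fun_prop)] at h
    convert h using 7 with i x
    simp only [Pi.mul_apply]
    rw [← ENNReal.ofReal_mul (hm0 _), hfm]
  · rw [hint]
    simp_rw [hfm]
    rw [integral_add (f := m) hmi (hpqi.const_mul ε), integral_const_mul]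
    rw [hpq, hm1]
    ring
  · rw [hint]
    -- Expanding, `m f² = m + 2 ε (p - q) + ε² (p - q)² / m` where `m > 0`, and `(p - q)² ≤ (p + q)²
    -- = 4 m²`. The linear term integrates to zero.
    have hle : ∀ x, m x * f x ^ 2 ≤ (1 + 4 * ε ^ 2) * m x + 2 * ε * (p x - q x) := by
      intro x
      by_cases h : m x = 0
      · have := hp0 x; have := hq0 x
        have h' : p x + q x = 0 := by simp only [hm] at h; linarith
        have hpx : p x = 0 := by linarith
        have hqx : q x = 0 := by linarith
        rw [h, hpx, hqx]; simp
      · have hpos : 0 < m x := lt_of_le_of_ne (hm0 x) (Ne.symm h)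
        have h1 : m x * f x ^ 2 = (m x * f x) ^ 2 / m x := by field_simp
        rw [h1, hfm, div_le_iff₀ hpos]
        simp only [hm]
        nlinarith [mul_nonneg (sq_nonneg ε) (mul_nonneg (hp0 x) (hq0 x))]
    have hri : Integrable (fun x => (1 + 4 * ε ^ 2) * m x + 2 * ε * (p x - q x)) μ :=
      (hmi.const_mul _).add (hpqi.const_mul _)
    refine (integral_mono_of_nonneg
      (ae_of_all _ fun x => mul_nonneg (hm0 x) (sq_nonneg _)) hri (ae_of_all _ hle)).trans ?_
    rw [integral_add (hmi.const_mul _) (hpqi.const_mul _), integral_const_mul,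
      integral_const_mul]
    rw [hpq, hm1]
    linarith

end Testing

/-! ### Two smooth densities with well separated embeddings -/

section Separation

variable {d : ℕ}

/-- The measure on `ℝ^d` with Lebesgue density `p`. -/
noncomputable def densityLaw (p : EuclideanSpace ℝ (Fin d) → ℝ) : Measure (EuclideanSpace ℝ (Fin d)) :=
  volume.withDensity fun x => ENNReal.ofReal (p x)

/-- Infinitely differentiable probability densities on `ℝ^d`. -/
structure IsSmoothDensity (p : EuclideanSpace ℝ (Fin d) → ℝ) : Prop where
  contDiff : ContDiff ℝ (⊤ : ℕ∞) p
  nonneg : ∀ x, 0 ≤ p x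
  integrable : Integrable p
  integral_eq_one : ∫ x, p x = 1

namespace IsSmoothDensity

variable {p q : EuclideanSpace ℝ (Fin d) → ℝ}

theorem measurable (hp : IsSmoothDensity p) : Measurable p :=
  hp.contDiff.continuous.measurable

theorem isProbabilityMeasure (hp : IsSmoothDensity p) : IsProbabilityMeasure (densityLaw p) := by
  refine ⟨?_⟩
  rw [densityLaw, withDensity_apply _ MeasurableSet.univ, Measure.restrict_univ,
    ← ofReal_integral_eq_lintegral_ofReal hp.integrable (ae_of_all _ hp.nonneg),
    hp.integral_eq_one, ENNReal.ofReal_one]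

theorem densityLaw_mem (hp : IsSmoothDensity p) : densityLaw p ∈ smoothDensityLaws d :=
  ⟨hp.isProbabilityMeasure, p, hp.contDiff, hp.nonneg, rfl⟩

theorem mix (hp : IsSmoothDensity p) (hq : IsSmoothDensity q) {ε : ℝ} (hε0 : 0 ≤ ε)
    (hε : ε ≤ 1 / 2) : IsSmoothDensity fun x => (p x + q x) / 2 + ε * (p x - q x) where
  contDiff := ((hp.contDiff.add hq.contDiff).div_const 2).add
    (contDiff_const.mul (hp.contDiff.sub hq.contDiff))
  nonneg x := by nlinarith [hp.nonneg x, hq.nonneg x]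
  integrable := ((hp.integrable.add hq.integrable).div_const 2).add
    ((hp.integrable.sub hq.integrable).const_mul ε)
  integral_eq_one := by
    have h : ∀ x, (p x + q x) / 2 + ε * (p x - q x) = (1 / 2 + ε) * p x + (1 / 2 - ε) * q x :=
      fun x => by ring
    simp_rw [h]
    rw [integral_add (hp.integrable.const_mul _) (hq.integrable.const_mul _), integral_const_mul,
      integral_const_mul, hp.integral_eq_one, hq.integral_eq_one]
    ring

end IsSmoothDensity

/-- A smooth bump function, normalized to integral one. -/
theorem isSmoothDensity_normed (f : ContDiffBump (0 : EuclideanSpace ℝ (Fin d))) :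
    IsSmoothDensity (f.normed volume) where
  contDiff := f.contDiff_normed
  nonneg := f.nonneg_normed
  integrable := f.integrable_normed
  integral_eq_one := f.integral_normed

theorem exists_isSmoothDensity_eq_zero {r : ℝ} (hr : 0 < r) :
    ∃ p : EuclideanSpace ℝ (Fin d) → ℝ, IsSmoothDensity p ∧ ∀ x, r ≤ ‖x‖ → p x = 0 := by
  let f : ContDiffBump (0 : EuclideanSpace ℝ (Fin d)) := ⟨r / 2, r, by positivity, by linarith⟩
  refine ⟨f.normed volume, isSmoothDensity_normed f, fun x hx => ?_⟩
  rw [← Function.notMem_support, f.support_normed_eq]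
  simpa [f] using hx

theorem exists_isSmoothDensity_le (hd : 1 ≤ d) {η : ℝ} (hη : 0 < η) :
    ∃ q : EuclideanSpace ℝ (Fin d) → ℝ, IsSmoothDensity q ∧ ∀ x, q x ≤ η := by
  set c : ℝ := (volume : Measure (EuclideanSpace ℝ (Fin d))).real (Metric.closedBall 0 1)
  have hc : 0 < c := ENNReal.toReal_pos (Metric.measure_closedBall_pos _ _ one_pos).ne'
    measure_closedBall_lt_top.ne
  -- A ball of radius `R` has volume `R ^ d * c`, which must be at least `1 / η`; `R ≥ 1` allows
  -- replacing `R ^ d` by `R`.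
  set R : ℝ := max 1 (1 / (η * c))
  have hR1 : 1 ≤ R := le_max_left _ _
  have hR0 : 0 < R := by linarith
  let f : ContDiffBump (0 : EuclideanSpace ℝ (Fin d)) := ⟨R, R + 1, hR0, by linarith⟩
  refine ⟨f.normed volume, isSmoothDensity_normed f, fun x => ?_⟩
  refine (f.normed_le_div_measure_closedBall_rIn volume x).trans ?_
  rw [Measure.addHaar_real_closedBall' _ _ f.rIn_pos.le, finrank_euclideanSpace_fin]
  change 1 / (R ^ d * c) ≤ η
  have hRd : R ≤ R ^ d := le_self_pow₀ hR1 (by omega)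
  have hRc : 1 / (η * c) ≤ R := le_max_right _ _
  rw [div_le_iff₀ (by positivity)] at hRc ⊢
  calc 1 ≤ R * (η * c) := hRc
    _ ≤ R ^ d * (η * c) := by gcongr
    _ = η * (R ^ d * c) := by ring

variable (ν : Measure ℝ≥0) [IsFiniteMeasure ν] {p q : EuclideanSpace ℝ (Fin d) → ℝ}

theorem kernelMean_densityLaw (hp : IsSmoothDensity p) (y : EuclideanSpace ℝ (Fin d)) :
    kernelMean ν (densityLaw p) y = ∫ x, p x * radialKernel ν y x := by
  have := hp.isProbabilityMeasure
  have hm := hp.measurable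
  rw [kernelMean_apply, densityLaw, integral_withDensity_eq_integral_toReal_smul (by fun_prop)
    (ae_of_all _ fun x => ENNReal.ofReal_lt_top)]
  simp_rw [ENNReal.toReal_ofReal (hp.nonneg _), smul_eq_mul]

theorem integrable_density_mul_radialKernel (hp : IsSmoothDensity p)
    (y : EuclideanSpace ℝ (Fin d)) : Integrable fun x => p x * radialKernel ν y x := by
  refine hp.integrable.mul_bdd (c := ν.real Set.univ)
    (continuous_radialKernel ν continuous_const continuous_id).aestronglyMeasurable
    (ae_of_all _ fun x => ?_)
  rw [Real.norm_of_nonneg (radialKernel_nonneg ν y _)]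
  exact radialKernel_le ν y _

theorem kernelMean_mix (hp : IsSmoothDensity p) (hq : IsSmoothDensity q) {ε : ℝ} (hε0 : 0 ≤ ε)
    (hε : ε ≤ 1 / 2) (y : EuclideanSpace ℝ (Fin d)) :
    kernelMean ν (densityLaw fun x => (p x + q x) / 2 + ε * (p x - q x)) y =
      (kernelMean ν (densityLaw p) y + kernelMean ν (densityLaw q) y) / 2 +
        ε * (kernelMean ν (densityLaw p) y - kernelMean ν (densityLaw q) y) := by
  rw [kernelMean_densityLaw ν (hp.mix hq hε0 hε), kernelMean_densityLaw ν hp,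
    kernelMean_densityLaw ν hq]
  have h : ∀ x, ((p x + q x) / 2 + ε * (p x - q x)) * radialKernel ν y x =
      (1 / 2 + ε) * (p x * radialKernel ν y x) + (1 / 2 - ε) * (q x * radialKernel ν y x) :=
    fun x => by ring
  simp_rw [h]
  rw [integral_add ((integrable_density_mul_radialKernel ν hp y).const_mul _)
    ((integrable_density_mul_radialKernel ν hq y).const_mul _), integral_const_mul,
    integral_const_mul]
  ring

/-- The embedding is a convolution with an integrable kernel, so a flat density has a uniformly
small embedding. -/
theorem kernelMean_densityLaw_le (hmoment : ∫⁻ t : ℝ≥0, (t : ℝ≥0∞) ^ (-(d : ℝ) / 2) ∂ν < ∞)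
    (hq : IsSmoothDensity q) {η : ℝ} (hη : ∀ x, q x ≤ η) (y : EuclideanSpace ℝ (Fin d)) :
    kernelMean ν (densityLaw q) y ≤
      η * ∫ x : EuclideanSpace ℝ (Fin d), radialKernel ν x 0 := by
  rw [kernelMean_densityLaw ν hq, ← integral_radialKernel ν y, ← integral_const_mul]
  simp_rw [radialKernel_comm ν y]
  refine integral_mono ?_ ((integrable_radialKernel ν hmoment y).const_mul η) fun x =>
    mul_le_mul_of_nonneg_right (hη x) (radialKernel_nonneg ν x y)
  simpa only [radialKernel_comm ν y] using integrable_density_mul_radialKernel ν hq y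

theorem mul_exp_le_kernelMean {δ₀ δ₁ β : ℝ≥0} (hν : (β : ℝ≥0∞) ≤ ν (Set.Icc δ₀ δ₁))
    (hp : IsSmoothDensity p) {r : ℝ} (hr : ∀ x, r ≤ ‖x‖ → p x = 0)
    (y : EuclideanSpace ℝ (Fin d)) :
    (β : ℝ) * Real.exp (-(δ₁ : ℝ) * (‖y‖ + r) ^ 2) ≤ kernelMean ν (densityLaw p) y := by
  rw [kernelMean_densityLaw ν hp]
  calc (β : ℝ) * Real.exp (-(δ₁ : ℝ) * (‖y‖ + r) ^ 2)
      = ∫ x, p x * ((β : ℝ) * Real.exp (-(δ₁ : ℝ) * (‖y‖ + r) ^ 2)) := by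
        rw [integral_mul_const, hp.integral_eq_one, one_mul]
    _ ≤ _ := by
        refine integral_mono (hp.integrable.mul_const _)
          (integrable_density_mul_radialKernel ν hp y) fun x => ?_
        rcases le_or_gt r ‖x‖ with h | h
        · simp [hr x h]
        · refine mul_le_mul_of_nonneg_left ?_ (hp.nonneg x)
          refine le_trans ?_ (mul_exp_le_radialKernel ν hν y x)
          have h1 : ‖y - x‖ ≤ ‖y‖ + r := (norm_sub_le y x).trans (by linarith)
          have h2 : ‖y - x‖ ^ 2 ≤ (‖y‖ + r) ^ 2 := pow_le_pow_left₀ (norm_nonneg _) h1 2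
          refine mul_le_mul_of_nonneg_left (Real.exp_le_exp.2 ?_) β.2
          nlinarith [δ₁.2, mul_le_mul_of_nonneg_left h2 δ₁.2]

/-- Widening the exponent by the factor `1 + 1/d` costs only `(1 + 1/d)^(d/2) ≤ e^(1/2)`, uniformly
in the dimension. -/
theorem exp_neg_one_mul_rpow_le (hd : 1 ≤ d) {a : ℝ} (ha : 0 < a) :
    Real.exp (-1) * (Real.pi / a) ^ ((d : ℝ) / 2) ≤
      Real.exp (-(1 / 2)) * (Real.pi / (a * (1 + 1 / d))) ^ ((d : ℝ) / 2) := by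
  have hd' : (0 : ℝ) < d := by exact_mod_cast hd
  have hb : (1 + 1 / (d : ℝ)) ^ ((d : ℝ) / 2) ≤ Real.exp (1 / 2) := by
    calc (1 + 1 / (d : ℝ)) ^ ((d : ℝ) / 2) ≤ Real.exp (1 / d) ^ ((d : ℝ) / 2) := by
          refine Real.rpow_le_rpow (by positivity) ?_ (by positivity)
          linarith [Real.add_one_le_exp (1 / (d : ℝ))]
      _ = Real.exp (1 / 2) := by
          rw [← Real.exp_mul]
          congr 1
          field_simp
  rw [← div_div, Real.div_rpow (x := Real.pi / a) (by positivity) (by positivity),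
    ← mul_div_assoc, le_div_iff₀ (by positivity)]
  calc Real.exp (-1) * (Real.pi / a) ^ ((d : ℝ) / 2) * (1 + 1 / (d : ℝ)) ^ ((d : ℝ) / 2)
      ≤ Real.exp (-1) * (Real.pi / a) ^ ((d : ℝ) / 2) * Real.exp (1 / 2) := by gcongr
    _ = Real.exp (-1 + 1 / 2) * (Real.pi / a) ^ ((d : ℝ) / 2) := by rw [Real.exp_add]; ring
    _ = _ := by norm_num

/-- A density concentrated near the origin has a mean embedding of large `L²` norm. -/
theorem exists_le_integral_sq_kernelMean (hd : 1 ≤ d)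
    (hmoment : ∫⁻ t : ℝ≥0, (t : ℝ≥0∞) ^ (-(d : ℝ) / 2) ∂ν < ∞)
    {δ₀ δ₁ β : ℝ≥0} (hδ : 0 < δ₁) (hν : (β : ℝ≥0∞) ≤ ν (Set.Icc δ₀ δ₁)) :
    ∃ p : EuclideanSpace ℝ (Fin d) → ℝ, IsSmoothDensity p ∧
      (β : ℝ) ^ 2 * (Real.exp (-1) * (Real.pi / (2 * (δ₁ : ℝ))) ^ ((d : ℝ) / 2)) ≤
        ∫ y, kernelMean ν (densityLaw p) y ^ 2 := by
  have hd' : (0 : ℝ) < d := by exact_mod_cast hd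
  have hδ' : (0 : ℝ) < δ₁ := by exact_mod_cast hδ
  -- The support radius is tuned so that the remainder `(1 + d) r²` in Young's inequality below
  -- costs exactly a factor `e^(-1/2)`.
  set r : ℝ := √(1 / (4 * δ₁ * (1 + d))) with hr
  have hr0 : 0 < r := Real.sqrt_pos.2 (by positivity)
  have hr2 : 2 * δ₁ * ((1 + d) * r ^ 2) = 1 / 2 := by
    rw [hr, Real.sq_sqrt (by positivity)]
    field_simp
    norm_num
  obtain ⟨p, hp, hpr⟩ := exists_isSmoothDensity_eq_zero (d := d) hr0
  refine ⟨p, hp, ?_⟩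
  have := hp.isProbabilityMeasure
  have hb : 0 < 2 * (δ₁ : ℝ) * (1 + 1 / d) := by positivity
  have hval := GaussianFourier.integral_rexp_neg_mul_sq_norm (V := EuclideanSpace ℝ (Fin d)) hb
  rw [finrank_euclideanSpace_fin] at hval
  have hint : Integrable fun y : EuclideanSpace ℝ (Fin d) =>
      Real.exp (-(2 * (δ₁ : ℝ) * (1 + 1 / d)) * ‖y‖ ^ 2) := by
    refine Integrable.of_integral_ne_zero ?_
    rw [hval]
    positivity
  have hpt : ∀ y : EuclideanSpace ℝ (Fin d),
      (β : ℝ) ^ 2 * (Real.exp (-(1 / 2)) *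
        Real.exp (-(2 * (δ₁ : ℝ) * (1 + 1 / d)) * ‖y‖ ^ 2)) ≤
        kernelMean ν (densityLaw p) y ^ 2 := by
    intro y
    refine le_trans ?_ (pow_le_pow_left₀ (by positivity) (mul_exp_le_kernelMean ν hν hp hpr y) 2)
    rw [mul_pow, ← Real.exp_nat_mul, ← Real.exp_add]
    refine mul_le_mul_of_nonneg_left (Real.exp_le_exp.2 ?_) (by positivity)
    -- Young's inequality with weight `1/d`, the weight for which the loss in the Gaussian integral
    -- stays bounded in `d`.
    have hyoung : (‖y‖ + r) ^ 2 ≤ (1 + 1 / d) * ‖y‖ ^ 2 + (1 + d) * r ^ 2 := by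
      have h1 : 0 ≤ (‖y‖ - d * r) ^ 2 / d := by positivity
      have h2 : (‖y‖ - d * r) ^ 2 / d = 1 / d * ‖y‖ ^ 2 - 2 * ‖y‖ * r + d * r ^ 2 := by
        field_simp
        ring
      linarith
    have h3 := mul_le_mul_of_nonneg_left hyoung (by positivity : 0 ≤ 2 * (δ₁ : ℝ))
    push_cast
    linarith
  calc (β : ℝ) ^ 2 * (Real.exp (-1) * (Real.pi / (2 * (δ₁ : ℝ))) ^ ((d : ℝ) / 2))
      ≤ (β : ℝ) ^ 2 * (Real.exp (-(1 / 2)) *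
          (Real.pi / (2 * (δ₁ : ℝ) * (1 + 1 / d))) ^ ((d : ℝ) / 2)) := by
        exact mul_le_mul_of_nonneg_left (exp_neg_one_mul_rpow_le hd (by positivity))
          (by positivity)
    _ = ∫ y : EuclideanSpace ℝ (Fin d), (β : ℝ) ^ 2 * (Real.exp (-(1 / 2)) *
          Real.exp (-(2 * (δ₁ : ℝ) * (1 + 1 / d)) * ‖y‖ ^ 2)) := by
        rw [integral_const_mul, integral_const_mul, hval]
    _ ≤ _ := integral_mono ((hint.const_mul _).const_mul _)
        (memLp_two_kernelMean ν _ hmoment).integrable_sq hpt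

/-- Two smooth densities whose mean embeddings are well separated in `L²`. -/
theorem exists_separated (hd : 1 ≤ d)
    (hmoment : ∫⁻ t : ℝ≥0, (t : ℝ≥0∞) ^ (-(d : ℝ) / 2) ∂ν < ∞)
    {δ₀ δ₁ β : ℝ≥0} (hδ : 0 < δ₁) (hβ : 0 < β) (hν : (β : ℝ≥0∞) ≤ ν (Set.Icc δ₀ δ₁)) :
    ∃ p q : EuclideanSpace ℝ (Fin d) → ℝ, IsSmoothDensity p ∧ IsSmoothDensity q ∧
      (β : ℝ) ^ 2 * (Real.exp (-1) * (Real.pi / (2 * (δ₁ : ℝ))) ^ ((d : ℝ) / 2)) / 2 ≤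
        ∫ y, (kernelMean ν (densityLaw p) y - kernelMean ν (densityLaw q) y) ^ 2 := by
  have hδ' : (0 : ℝ) < δ₁ := by exact_mod_cast hδ
  have hβ' : (0 : ℝ) < β := by exact_mod_cast hβ
  obtain ⟨p, hp, hpN⟩ := exists_le_integral_sq_kernelMean (d := d) ν hd hmoment hδ hν
  set N : ℝ := (β : ℝ) ^ 2 * (Real.exp (-1) * (Real.pi / (2 * (δ₁ : ℝ))) ^ ((d : ℝ) / 2)) with hN
  have hN0 : 0 < N := by positivity
  set K : ℝ := ∫ x : EuclideanSpace ℝ (Fin d), radialKernel ν x 0 with hK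
  -- This bound makes the cross term `2 η K²` at most `N / 2`; the `+ 1` avoids having to show `K ≠
  -- 0`.
  obtain ⟨q, hq, hqη⟩ := exists_isSmoothDensity_le hd
    (show 0 < N / (4 * (K ^ 2 + 1)) by positivity)
  refine ⟨p, q, hp, hq, ?_⟩
  have hP := hp.isProbabilityMeasure
  have hQ := hq.isProbabilityMeasure
  have hpL := memLp_two_kernelMean ν (densityLaw p) hmoment
  have hqL := memLp_two_kernelMean ν (densityLaw q) hmoment
  have hpi := integrable_kernelMean ν (densityLaw p) hmoment
  set η : ℝ := N / (4 * (K ^ 2 + 1)) with hη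
  have hηK : η * K ^ 2 ≤ N / 4 := by
    have h1 : η * (4 * (K ^ 2 + 1)) = N := div_mul_cancel₀ _ (by positivity)
    have h2 : 0 < η := by positivity
    nlinarith
  -- From `(a - b)² ≥ a² - 2 a b` and `b ≤ η K`. Only the integral of `a` remains, and it equals
  -- `K`.
  have hle : ∀ y, kernelMean ν (densityLaw p) y ^ 2 - 2 * (η * K) * kernelMean ν (densityLaw p) y ≤
      (kernelMean ν (densityLaw p) y - kernelMean ν (densityLaw q) y) ^ 2 := by
    intro y
    have h1 := mul_le_mul_of_nonneg_left (kernelMean_densityLaw_le ν hmoment hq hqη y)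
      (kernelMean_nonneg ν (densityLaw p) y)
    nlinarith [sq_nonneg (kernelMean ν (densityLaw q) y)]
  calc N / 2 ≤ (∫ y, kernelMean ν (densityLaw p) y ^ 2) - 2 * (η * K) * K := by nlinarith
    _ = ∫ y, (kernelMean ν (densityLaw p) y ^ 2 -
          2 * (η * K) * kernelMean ν (densityLaw p) y) := by
        rw [integral_sub hpL.integrable_sq (hpi.const_mul _), integral_const_mul,
          integral_kernelMean ν (densityLaw p) hmoment]
    _ ≤ _ := integral_mono (hpL.integrable_sq.sub (hpi.const_mul _))
        (hpL.sub hqL).integrable_sq hle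

end Separation

/-! ### Le Cam's reduction and the numerical constants -/

section Minimax

theorem ofReal_le_eLpNorm_two {X : Type*} [MeasurableSpace X] {μ : Measure X} {g : X → ℝ}
    (hg : MemLp g 2 μ) {s : ℝ} (hs : s ^ 2 ≤ ∫ x, g x ^ 2 ∂μ) :
    ENNReal.ofReal s ≤ eLpNorm g 2 μ := by
  rw [hg.eLpNorm_eq_integral_rpow_norm two_ne_zero ENNReal.ofNat_ne_top]
  refine ENNReal.ofReal_le_ofReal ?_
  simp only [ENNReal.toReal_ofNat, Real.rpow_two, Real.norm_eq_abs, sq_abs]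
  rw [show (2 : ℝ)⁻¹ = 1 / 2 by norm_num, ← Real.sqrt_eq_rpow]
  exact Real.le_sqrt_of_sq_le hs

variable {d n : ℕ}

/-- The event is the preimage under the estimator of a closed subset of `L²`, the complement of an
open ball around the class of `g`. -/
theorem measurableSet_le_l2Error (θ : L2Estimator d n) {g : EuclideanSpace ℝ (Fin d) → ℝ}
    (hg : MemLp g 2 volume) (s : ℝ≥0∞) : MeasurableSet {X | s ≤ l2Error (θ.1 X) g} := by
  have h : ∀ f : Lp ℝ 2 (volume : Measure (EuclideanSpace ℝ (Fin d))),
      l2Error f g = ‖f - hg.toLp g‖ₑ := by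
    intro f
    rw [l2Error, Lp.enorm_def]
    refine eLpNorm_congr_ae ?_
    filter_upwards [Lp.coeFn_sub f (hg.toLp g), hg.coeFn_toLp] with y h1 h2
    rw [h1, Pi.sub_apply, h2]
  simp_rw [h]
  have hclosed : IsClosed {f : Lp ℝ 2 (volume : Measure (EuclideanSpace ℝ (Fin d))) |
      s ≤ ‖f - hg.toLp g‖ₑ} := isClosed_le continuous_const (by fun_prop)
  let : MeasurableSpace (Lp ℝ 2 (volume : Measure (EuclideanSpace ℝ (Fin d)))) := borel _
  have : BorelSpace (Lp ℝ 2 (volume : Measure (EuclideanSpace ℝ (Fin d)))) := ⟨rfl⟩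
  exact θ.2 hclosed.measurableSet

/-- If two parameter values are `2 s` apart, every estimator is at distance at least `s` from one
of them. -/
theorem le_l2Error_or_le_l2Error
    (f : Lp ℝ 2 (volume : Measure (EuclideanSpace ℝ (Fin d))))
    {g h : EuclideanSpace ℝ (Fin d) → ℝ} (hg : MemLp g 2 volume) (hh : MemLp h 2 volume)
    {s : ℝ} (hs : 0 ≤ s) (hgh : ENNReal.ofReal (2 * s) ≤ eLpNorm (fun y => g y - h y) 2 volume) :
    ENNReal.ofReal s ≤ l2Error f g ∨ ENNReal.ofReal s ≤ l2Error f h := by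
  by_contra! hcon
  have hf := Lp.memLp f
  have htri : eLpNorm (fun y => g y - h y) 2 volume ≤ l2Error f h + l2Error f g := by
    have h1 : (fun y => g y - h y) = (fun y => f y - h y) - fun y => f y - g y := by
      ext y
      simp
    rw [h1]
    exact eLpNorm_sub_le (hf.sub hh).1 (hf.sub hg).1 one_le_two
  have h2 : ENNReal.ofReal (2 * s) = ENNReal.ofReal s + ENNReal.ofReal s := by
    rw [← ENNReal.ofReal_add hs hs, two_mul]
  exact absurd (hgh.trans htri) (not_le.2 (h2 ▸ ENNReal.add_lt_add hcon.2 hcon.1))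

/-- Le Cam's two-point bound. -/
theorem one_fifth_le_iSup (θ : L2Estimator d n) {P Q : Measure (EuclideanSpace ℝ (Fin d))}
    (hP : P ∈ smoothDensityLaws d) (hQ : Q ∈ smoothDensityLaws d)
    {g : Measure (EuclideanSpace ℝ (Fin d)) → EuclideanSpace ℝ (Fin d) → ℝ}
    (hgP : MemLp (g P) 2 volume) (hgQ : MemLp (g Q) 2 volume) {s : ℝ} (hs : 0 ≤ s)
    (hsep : ENNReal.ofReal (2 * s) ≤ eLpNorm (fun y => g P y - g Q y) 2 volume)
    (htest : ∀ A : Set (Fin n → EuclideanSpace ℝ (Fin d)), MeasurableSet A →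
      (Measure.pi fun _ : Fin n => P).real A ≤
        (Measure.pi fun _ : Fin n => Q).real A + 3 / 5) :
    1 / 5 ≤ ⨆ P ∈ smoothDensityLaws d, Measure.pi (fun _ : Fin n => P)
      {X | ENNReal.ofReal s ≤ l2Error (θ.1 X) (g P)} := by
  have := hP.1
  have := hQ.1
  set A := {X | ENNReal.ofReal s ≤ l2Error (θ.1 X) (g P)} with hA
  set B := {X | ENNReal.ofReal s ≤ l2Error (θ.1 X) (g Q)} with hB
  have hAm : MeasurableSet A := measurableSet_le_l2Error θ hgP _
  have hsub : Aᶜ ⊆ B := fun X hX =>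
    (le_l2Error_or_le_l2Error (θ.1 X) hgP hgQ hs hsep).resolve_left hX
  have h1 := htest Aᶜ hAm.compl
  rw [probReal_compl_eq_one_sub hAm] at h1
  have h2 : (Measure.pi fun _ : Fin n => Q).real Aᶜ ≤ (Measure.pi fun _ : Fin n => Q).real B :=
    measureReal_mono hsub
  have key : ∀ (R : Measure (EuclideanSpace ℝ (Fin d))), R ∈ smoothDensityLaws d →
      1 / 5 ≤ (Measure.pi fun _ : Fin n => R).real
        {X | ENNReal.ofReal s ≤ l2Error (θ.1 X) (g R)} →
      1 / 5 ≤ ⨆ P ∈ smoothDensityLaws d, Measure.pi (fun _ : Fin n => P)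
        {X | ENNReal.ofReal s ≤ l2Error (θ.1 X) (g P)} := by
    intro R hR h
    have := hR.1
    refine le_trans ?_ (le_iSup₂_of_le R hR le_rfl)
    rw [measureReal_def, ← ENNReal.ofReal_le_iff_le_toReal (measure_ne_top _ _)] at h
    refine le_trans (le_of_eq ?_) h
    rw [ENNReal.ofReal_div_of_pos (by norm_num)]
    simp
  -- If the error probability under `P` is below `1/5`, the one under `Q` exceeds `1 - 1/5 - 3/5 =
  -- 1/5`.
  rcases le_or_gt (1 / 5) ((Measure.pi fun _ : Fin n => P).real A) with h | h
  · exact key P hP h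
  · exact key Q hQ (by linarith)

/-- Here `4 n ε² = 1/25`, so the radicand is at most `e^(1/25) - 1 ≤ 1/24`, well below `9/25`. -/
theorem sqrt_one_add_pow_sub_one_le {ε : ℝ} (hn : 1 ≤ n) (hε : ε ^ 2 = 1 / (100 * n)) :
    √((1 + 4 * ε ^ 2) ^ n - 1) ≤ 3 / 5 := by
  have hn' : (0 : ℝ) < n := by exact_mod_cast hn
  refine Real.sqrt_le_iff.2 ⟨by norm_num, ?_⟩
  have h1 : (1 + 4 * ε ^ 2) ^ n ≤ Real.exp (1 / 25) := by
    calc (1 + 4 * ε ^ 2) ^ n ≤ Real.exp (4 * ε ^ 2) ^ n := by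
          refine pow_le_pow_left₀ (by positivity) ?_ n
          linarith [Real.add_one_le_exp (4 * ε ^ 2)]
      _ = Real.exp (1 / 25) := by
          rw [← Real.exp_nat_mul, hε]
          congr 1
          field_simp
          norm_num
  have h2 : Real.exp (1 / 25) ≤ 1 / (1 - 1 / 25) :=
    Real.exp_bound_div_one_sub_of_interval (by norm_num) (by norm_num)
  norm_num at h2 ⊢
  linarith

end Minimax

end RadialKME

/-! ### The minimax lower bound -/

theorem theorem13 (d n : ℕ) (hd : 1 ≤ d) (hn : 1 ≤ n)
    (ν : Measure ℝ≥0) [IsFiniteMeasure ν]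
    (hmoment : ∫⁻ t : ℝ≥0, (t : ℝ≥0∞) ^ (-(d : ℝ) / 2) ∂ν < ∞)
    (hsupp : ν.support ≠ {0})
    (δ₀ δ₁ β : ℝ≥0) (hδ₀ : 0 < δ₀) (hδ : δ₀ ≤ δ₁) (hβ : 0 < β)
    (hν : (β : ℝ≥0∞) ≤ ν (Set.Icc δ₀ δ₁)) :
    (∀ P ∈ RadialKME.smoothDensityLaws d, MemLp (RadialKME.kernelMean ν P) 2 volume) ∧
    1 / 5 ≤ RadialKME.minimaxProbability d n ν
      (1 / 50 * Real.sqrt (1 / (n : ℝ) * (Real.pi / (2 * (δ₁ : ℝ))) ^ ((d : ℝ) / 2) *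
        ((β : ℝ) ^ 2 * (δ₀ : ℝ) / ((δ₁ : ℝ) * Real.exp 1)) * (1 - 2 / (2 + (d : ℝ))))) := by
  have hmem : ∀ P ∈ RadialKME.smoothDensityLaws d,
      MemLp (RadialKME.kernelMean ν P) 2 volume := fun P hP =>
    have := hP.1
    RadialKME.memLp_two_kernelMean ν P hmoment
  refine ⟨hmem, le_iInf fun θ => ?_⟩
  have hδ₁ : 0 < δ₁ := hδ₀.trans_le hδ
  have hδ₁' : (0 : ℝ) < δ₁ := by exact_mod_cast hδ₁
  have hδ' : (δ₀ : ℝ) ≤ δ₁ := by exact_mod_cast hδ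
  have hn' : (1 : ℝ) ≤ n := by exact_mod_cast hn
  have hn0 : (0 : ℝ) < n := by linarith
  obtain ⟨p, q, hp, hq, hpq⟩ :=
    RadialKME.exists_separated (d := d) ν hd hmoment hδ₁ hβ hν
  set N : ℝ := (β : ℝ) ^ 2 *
    (Real.exp (-1) * (Real.pi / (2 * (δ₁ : ℝ))) ^ ((d : ℝ) / 2)) with hN
  set S : ℝ := 1 / (n : ℝ) * (Real.pi / (2 * (δ₁ : ℝ))) ^ ((d : ℝ) / 2) *
    ((β : ℝ) ^ 2 * (δ₀ : ℝ) / ((δ₁ : ℝ) * Real.exp 1)) * (1 - 2 / (2 + (d : ℝ))) with hS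
  have hN0 : 0 ≤ N := by positivity
  have hSN : S = N / n * ((δ₀ / δ₁) * (1 - 2 / (2 + (d : ℝ)))) := by
    rw [hS, hN, Real.exp_neg]
    field_simp
  have hd2 : 2 / (2 + (d : ℝ)) ≤ 1 := by
    rw [div_le_one (by positivity)]
    have : (0 : ℝ) ≤ d := Nat.cast_nonneg d
    linarith
  have hd3 : 0 ≤ 2 / (2 + (d : ℝ)) := by positivity
  have hratio : (δ₀ / δ₁ : ℝ) * (1 - 2 / (2 + (d : ℝ))) ≤ 1 :=
    mul_le_one₀ (div_le_one_of_le₀ hδ' hδ₁'.le) (by linarith) (by linarith)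
  have hS0 : 0 ≤ S := by
    rw [hSN]
    exact mul_nonneg (by positivity) (mul_nonneg (by positivity) (by linarith))
  have hSle : S ≤ N / n := by
    rw [hSN]
    exact mul_le_of_le_one_right (by positivity) hratio
  set ε : ℝ := √(1 / (100 * n)) with hε
  have hε0 : 0 ≤ ε := Real.sqrt_nonneg _
  have hε2 : ε ^ 2 = 1 / (100 * n) := Real.sq_sqrt (by positivity)
  have hεle : ε ≤ 1 / 2 := by
    refine Real.sqrt_le_iff.2 ⟨by norm_num, ?_⟩
    rw [div_le_iff₀ (by positivity)]
    linarith
  -- The midpoint is the mixture with `ε = 0`.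
  have hP : RadialKME.IsSmoothDensity fun x => (p x + q x) / 2 := by
    simpa using hp.mix hq le_rfl (by norm_num)
  have hQ := hp.mix hq hε0 hεle
  have hPmem := hmem _ hP.densityLaw_mem
  have hQmem := hmem _ hQ.densityLaw_mem
  refine RadialKME.one_fifth_le_iSup θ hP.densityLaw_mem hQ.densityLaw_mem hPmem hQmem
    (by positivity) ?_ fun A hA => ?_
  · refine RadialKME.ofReal_le_eLpNorm_two (hPmem.sub hQmem) ?_
    have hdiff : ∀ y, (RadialKME.kernelMean ν (RadialKME.densityLaw fun x => (p x + q x) / 2) y -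
        RadialKME.kernelMean ν
          (RadialKME.densityLaw fun x => (p x + q x) / 2 + ε * (p x - q x)) y) ^ 2 =
        ε ^ 2 * (RadialKME.kernelMean ν (RadialKME.densityLaw p) y -
          RadialKME.kernelMean ν (RadialKME.densityLaw q) y) ^ 2 := by
      intro y
      have h0 := RadialKME.kernelMean_mix ν hp hq le_rfl (by norm_num) y
      simp only [zero_mul, add_zero] at h0
      rw [h0, RadialKME.kernelMean_mix ν hp hq hε0 hεle]
      ring
    simp only [Pi.sub_apply]
    simp_rw [hdiff]
    rw [integral_const_mul, hε2]
    -- The available squared separation is `ε² N / 2 = N / (200 n)`, while `(2 / 50)² S ≤ N / (625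
    -- n)` is needed.
    calc (2 * (1 / 50 * √S)) ^ 2 = 1 / 625 * S := by
          rw [mul_pow, mul_pow, Real.sq_sqrt hS0]
          ring
      _ ≤ 1 / 625 * (N / n) := by gcongr
      _ ≤ 1 / 200 * (N / n) := by gcongr; norm_num
      _ = 1 / (100 * n) * (N / 2) := by ring
      _ ≤ _ := by gcongr
  · refine (RadialKME.pi_mixture_real_le volume hp.measurable hq.measurable hp.nonneg hq.nonneg
      hp.integrable hq.integrable hp.integral_eq_one hq.integral_eq_one hε0 hεle n hA).trans ?_
    have := RadialKME.sqrt_one_add_pow_sub_one_le hn hε2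
    gcongr
    exact le_rfl
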